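/- Let $K$ be a field, let $n\ge 3$ be an integer, and let $S=K[x_1,\dots,x_n]$ with graded maximal ideal $\mathfrak m=(x_1,\dots,x_n)$. Let $J_{n,n-1}\subset S$ be the path ideal of length $n-1$ of the $n$-cycle $C_n$ on the vertices $x_1,\dots,x_n$, that is, the ideal generated by the products $\prod_{v\in P}x_v$, where $P$ runs over the paths of $C_n$ with exactly $n-1$ vertices (the length of a path is counted by its vertices). Then $$\operatorname{sdepth}(S/J_{n,n-1})=\operatorname{depth}(S/J_{n,n-1})=n-2 .$$ Here $\operatorname{depth}(M)=\min\{i\mid \operatorname{Ext}^i_S(S/\mathfrak m,M)\neq 0\}$. For a $\mathbb Z^n$-graded $S$-module $M$, a Stanley space of $M$ is a $K$-subspace $uK[Z]=\{fu\mid f\in K[Z]\}$ with $u\in M$ homogeneous and $Z\subseteq\{x_1,\dots,x_n\}$ such that $uK[Z]$ is a free $K[Z]$-module with basis $u$; a Stanley decomposition of $M$ is a decomposition $\mathcal D: M=\bigoplus_{i=1}^r u_iK[Z_i]$ of the $K$-vector space $M$ as a finite direct sum of Stanley spaces, $\operatorname{sdepth}(\mathcal D)=\min_i|Z_i|$, and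 $\operatorname{sdepth}(M)$ is the maximum of $\operatorname{sdepth}(\mathcal D)$ over all Stanley decompositions $\mathcal D$ of $M$. -/

import Mathlib

open MvPolynomial

noncomputable section

universe u

/-- The path ideal of length `m` of a graph `G` on the vertex set `σ`: the ideal of `K[x_v : v ∈ σ]`
generated by the products of the variables along the paths of `G` with exactly `m` vertices.
(The length of a path is counted here by its number of vertices; `p.support` is the list of the
vertices of `p`, without repetition as `p` is a path.) -/
def pathIdeal (K : Type u) [Field K] {σ : Type} (G : SimpleGraph σ) (m : ℕ) :
    Ideal (MvPolynomial σ K) :=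
  Ideal.span {f | ∃ (v w : σ) (p : G.Walk v w), p.IsPath ∧ p.support.length = m ∧
    f = (p.support.map (fun i => (X i : MvPolynomial σ K))).prod}

/-- The path ideal `J_{n,m}` of length `m` of the `n`-cycle, in `K[x_1, …, x_n]`
(with the variables indexed by `Fin n`). -/
def cyclePathIdeal (K : Type u) [Field K] (n m : ℕ) : Ideal (MvPolynomial (Fin n) K) :=
  pathIdeal K (SimpleGraph.cycleGraph n) m

/-- The depth of a module `M` over `S = K[x_v : v ∈ σ]`: the least `i` with `Ext^i(S/𝔪, M) ≠ 0`,
where `𝔪` is the ideal generated by the variables (and `⊤` if there is no such `i`). -/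
def gradedDepth (K : Type u) [Field K] (σ : Type) (M : Type u) [AddCommGroup M]
    [Module (MvPolynomial σ K) M] : ℕ∞ :=
  ⨅ (i : ℕ) (_ : Nontrivial (CategoryTheory.Abelian.Ext
    (ModuleCat.of (MvPolynomial σ K) (MvPolynomial σ K ⧸ idealOfVars σ K))
    (ModuleCat.of (MvPolynomial σ K) M) i)), (i : ℕ∞)

section Stanley

variable {K : Type u} [Field K] {σ : Type} {M : Type u} [AddCommGroup M] [Module K M]
  [Module (MvPolynomial σ K) M] [IsScalarTower K (MvPolynomial σ K) M]

/-- The `K`-subspace `u K[Z]` of `M`, for `u ∈ M` and a set `Z` of variables: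
it consists of the elements `f • u` with `f ∈ K[Z]`. -/
def stanleySubspace (u : M) (Z : Finset σ) : Submodule K M :=
  (Subalgebra.toSubmodule (supported K (Z : Set σ))).map
    ((LinearMap.toSpanSingleton (MvPolynomial σ K) M u).restrictScalars K)

/-- `u K[Z]` is a Stanley space of `M` (with respect to the `ℤ^σ`-grading `𝓜` of `M`): `u` is
homogeneous, and `u K[Z]` is a free `K[Z]`-module with basis `u`. -/
def IsStanleySpace (𝓜 : (σ → ℤ) → Submodule K M) (u : M) (Z : Finset σ) : Prop :=
  (∃ a, u ∈ 𝓜 a) ∧ ∀ f ∈ supported K (Z : Set σ), f • u = 0 → f = 0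

/-- A Stanley decomposition of `M` (with respect to the `ℤ^σ`-grading `𝓜` of `M`): a
decomposition of `M` as a finite direct sum of Stanley spaces `u_i K[Z_i]`. -/
structure StanleyDecomposition (𝓜 : (σ → ℤ) → Submodule K M) where
  /-- The number of summands. -/
  r : ℕ
  /-- The homogeneous generators. -/
  u : Fin r → M
  /-- The sets of variables. -/
  Z : Fin r → Finset σ
  isStanleySpace : ∀ i, IsStanleySpace 𝓜 (u i) (Z i)
  isInternal : DirectSum.IsInternal (fun i => stanleySubspace (K := K) (u i) (Z i))

/-- The Stanley depth of a Stanley decomposition: the least of the `|Z_i|`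
(`⊤` if there are no summands, that is, if `M = 0`). -/
def StanleyDecomposition.sdepth {𝓜 : (σ → ℤ) → Submodule K M} (D : StanleyDecomposition 𝓜) : ℕ∞ :=
  ⨅ i, ((D.Z i).card : ℕ∞)

/-- The Stanley depth of `M` with its `ℤ^σ`-grading `𝓜`: the greatest Stanley depth of a Stanley
decomposition of `M`. -/
def stanleyDepth (𝓜 : (σ → ℤ) → Submodule K M) : ℕ∞ :=
  ⨆ D : StanleyDecomposition 𝓜, D.sdepth

/-- The standard `ℤ^σ`-grading of `S/I` for a monomial ideal `I` of `S = K[x_v : v ∈ σ]`: the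
component of degree `a` is spanned by the class of `x^a` if `a` has no negative entry, and is zero
otherwise. -/
def quotientGrading (I : Ideal (MvPolynomial σ K)) (a : σ → ℤ) :
    Submodule K (MvPolynomial σ K ⧸ I) :=
  Submodule.span K {y | ∃ b : σ →₀ ℕ, (∀ i, (b i : ℤ) = a i) ∧
    y = Ideal.Quotient.mk I (monomial b 1)}

end Stanley

end

/-!
The cycle `C_n` has one path on `n - 1` vertices for each omitted vertex, as a set of vertices, so
the path ideal `J` is generated by the products of all but one of the variables
(`cyclePathIdeal_eq_omitOneIdeal`). A monomial lies outside `J` exactly when at least two variables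
do not occur in it.

*Depth.* For a set `s` of variables let `J_s` be generated by the products of all but one of the
variables in `s`. For `a ∉ s` one has `J_{s ∪ {a}} = x_a J_s + (∏_{l ∈ s} x_l)`, hence
`(J_{s ∪ {a}} : x_a) = J_s`, and there is an exact sequence
`0 → S/J_s → S/J_{s ∪ {a}} → S/(x_a, ∏_{l ∈ s} x_l) → 0`. The last module is the quotient by a
regular sequence of length two, so its depth is at least `n - 2`, and induction from the case
`|s| = 2`, where `J_s` is generated by two variables, gives depth `n - 2` for every `S/J_s` with
`|s| ≥ 2` (`hasDepth_omitOneIdeal`). The depth of a quotient by variables comes from the long exact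
sequence of `Ext` for multiplication by a variable, which is zero on `Ext^i(S/𝔪, -)`
(`HasDepth.of_regular`, `hasDepth_span_X_image`).

*Stanley depth.* If `u K[Z]` is a Stanley space of `S/J` then `|Z| ≤ n - 2`, since a product of
`n - 1` variables lies in `J` (`IsStanleySpace.card_add_two_le`). Conversely, sorting the monomials
outside `J` by the first two variables `x_i`, `x_j` that do not occur in them decomposes `S/J` into
the Stanley spaces `(∏_{k < j, k ≠ i} x_k) K[x_l : l ≠ i, j]`, all of dimension `n - 2`
(`omitOneStanleyDecomposition`).
-/

universe u

/-! ### `Ext^i(R/I, -)` and depth along short exact sequences -/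

section ExtOfModules

open CategoryTheory

variable {R : Type u} [CommRing R]

/-- `Ext^i(R/I, M)` for a module `M` over a commutative ring `R` and an ideal `I`. -/
abbrev extQuotient (I : Ideal R) (M : Type u) [AddCommGroup M] [Module R M] (i : ℕ) : Type u :=
  Abelian.Ext (ModuleCat.of R (R ⧸ I)) (ModuleCat.of R M) i

variable {I : Ideal R} {A B C : Type u} [AddCommGroup A] [Module R A] [AddCommGroup B] [Module R B]
  [AddCommGroup C] [Module R C] {f : A →ₗ[R] B} {g : B →ₗ[R] C} {i : ℕ}

lemma exists_moduleCat_shortExact (hf : Function.Injective f) (hfg : Function.Exact f g)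
    (hg : Function.Surjective g) :
    ∃ w, (ShortComplex.mk (ModuleCat.ofHom f) (ModuleCat.ofHom g) w).ShortExact := by
  refine ⟨by ext x; exact hfg.apply_apply_eq_zero x, ?_⟩
  exact { exact := (ShortComplex.ShortExact.moduleCat_exact_iff_function_exact _).2 hfg
          mono_f := (ModuleCat.mono_iff_injective _).2 hf
          epi_g := (ModuleCat.epi_iff_surjective _).2 hg }

lemma extQuotient_subsingleton_middle (hf : Function.Injective f) (hfg : Function.Exact f g)
    (hg : Function.Surjective g) (hA : Subsingleton (extQuotient I A i))
    (hC : Subsingleton (extQuotient I C i)) : Subsingleton (extQuotient I B i) := by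
  obtain ⟨w, hS⟩ := exists_moduleCat_shortExact hf hfg hg
  refine subsingleton_of_forall_eq 0 fun x => ?_
  obtain ⟨y, rfl⟩ := Abelian.Ext.covariant_sequence_exact₂ _ hS x (hC.elim _ _)
  rw [hA.elim y 0, Abelian.Ext.zero_comp]

lemma extQuotient_subsingleton_right (hf : Function.Injective f) (hfg : Function.Exact f g)
    (hg : Function.Surjective g) (hB : Subsingleton (extQuotient I B i))
    (hA : Subsingleton (extQuotient I A (i + 1))) : Subsingleton (extQuotient I C i) := by
  obtain ⟨w, hS⟩ := exists_moduleCat_shortExact hf hfg hg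
  refine subsingleton_of_forall_eq 0 fun x => ?_
  obtain ⟨y, rfl⟩ := Abelian.Ext.covariant_sequence_exact₃ _ hS x rfl (hA.elim _ _)
  rw [hB.elim y 0, Abelian.Ext.zero_comp]

lemma extQuotient_nontrivial_left (hf : Function.Injective f) (hfg : Function.Exact f g)
    (hg : Function.Surjective g) (hB : Subsingleton (extQuotient I B i))
    (hC : Nontrivial (extQuotient I C i)) : Nontrivial (extQuotient I A (i + 1)) := by
  by_contra h
  rw [not_nontrivial_iff_subsingleton] at h
  exact not_subsingleton_iff_nontrivial.2 hC (extQuotient_subsingleton_right hf hfg hg hB h)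

lemma extQuotient_zero_subsingleton_left (hf : Function.Injective f)
    (hB : Subsingleton (extQuotient I B 0)) : Subsingleton (extQuotient I A 0) := by
  have : Mono (ModuleCat.ofHom f) := (ModuleCat.mono_iff_injective _).2 hf
  exact (Abelian.Ext.postcomp_mk₀_injective_of_mono (ModuleCat.of R (R ⧸ I))
    (ModuleCat.ofHom f)).subsingleton

lemma extQuotient_succ_subsingleton_left (hf : Function.Injective f) (hfg : Function.Exact f g)
    (hg : Function.Surjective g) (hC : Subsingleton (extQuotient I C i))
    (hB : Subsingleton (extQuotient I B (i + 1))) : Subsingleton (extQuotient I A (i + 1)) := by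
  obtain ⟨w, hS⟩ := exists_moduleCat_shortExact hf hfg hg
  refine subsingleton_of_forall_eq 0 fun x => ?_
  obtain ⟨y, rfl⟩ := Abelian.Ext.covariant_sequence_exact₁ _ hS x (hB.elim _ _) rfl
  rw [hC.elim y 0, Abelian.Ext.zero_comp]

/-- The elements of `I` annihilate `Ext^i(R/I, M)`, because they annihilate `R/I`. -/
lemma smul_extQuotient_eq_zero {r : R} (hr : r ∈ I) (x : extQuotient I A i) : r • x = 0 := by
  have h : r • 𝟙 (ModuleCat.of R (R ⧸ I)) = 0 := by
    ext
    change Ideal.Quotient.mk I (r * 1) = 0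
    rwa [mul_one, Ideal.Quotient.eq_zero_iff_mem]
  rw [← Abelian.Ext.mk₀_id_comp x, ← Abelian.Ext.smul_comp, ← Abelian.Ext.mk₀_smul, h,
    Abelian.Ext.mk₀_zero, Abelian.Ext.zero_comp]

lemma extQuotient_comp_smul_eq_zero {r : R} (hr : r ∈ I) (x : extQuotient I A i) :
    x.comp (Abelian.Ext.mk₀ (ModuleCat.ofHom (r • (LinearMap.id : A →ₗ[R] A)))) (add_zero i)
      = 0 := by
  rw [← smul_extQuotient_eq_zero hr x, Abelian.Ext.smul_eq_comp_mk₀]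
  rfl

/-- If `r ∈ I` is regular on `A` then `Ext^0(R/I, A) = Hom(R/I, A)` vanishes. -/
lemma extQuotient_zero_subsingleton_of_regular {r : R} (hr : r ∈ I)
    (hf : Function.Injective (r • (LinearMap.id : A →ₗ[R] A))) :
    Subsingleton (extQuotient I A 0) := by
  have : Mono (ModuleCat.ofHom (r • (LinearMap.id : A →ₗ[R] A))) :=
    (ModuleCat.mono_iff_injective _).2 hf
  refine subsingleton_of_forall_eq 0 fun x => ?_
  apply Abelian.Ext.postcomp_mk₀_injective_of_mono (ModuleCat.of R (R ⧸ I))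
    (ModuleCat.ofHom (r • (LinearMap.id : A →ₗ[R] A)))
  simpa using extQuotient_comp_smul_eq_zero hr x

/-- If `r ∈ I` is regular on `A` with cokernel `C`, the connecting map from `Ext^i(R/I, C)` to
`Ext^{i+1}(R/I, A)` is onto, as multiplication by `r` is zero on `Ext^{i+1}(R/I, A)`. -/
lemma extQuotient_succ_subsingleton_of_regular {r : R} (hr : r ∈ I)
    {g : A →ₗ[R] C} (hf : Function.Injective (r • (LinearMap.id : A →ₗ[R] A)))
    (hfg : Function.Exact (r • (LinearMap.id : A →ₗ[R] A)) g) (hg : Function.Surjective g)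
    (hC : Subsingleton (extQuotient I C i)) : Subsingleton (extQuotient I A (i + 1)) := by
  obtain ⟨w, hS⟩ := exists_moduleCat_shortExact hf hfg hg
  refine subsingleton_of_forall_eq 0 fun x => ?_
  obtain ⟨y, rfl⟩ := Abelian.Ext.covariant_sequence_exact₁ _ hS x
    (extQuotient_comp_smul_eq_zero hr x) rfl
  rw [hC.elim y 0, Abelian.Ext.zero_comp]

/-- The vanishing of `Ext^i(R/I, M)` for all `i < d`, that is, "`depth M ≥ d`". -/
def DepthGE (I : Ideal R) (M : Type u) [AddCommGroup M] [Module R M] (d : ℕ) : Prop :=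
  ∀ i < d, Subsingleton (extQuotient I M i)

/-- `Ext^i(R/I, M)` vanishes for `i < d` and not for `i = d`, that is, "`depth M = d`". -/
def HasDepth (I : Ideal R) (M : Type u) [AddCommGroup M] [Module R M] (d : ℕ) : Prop :=
  DepthGE I M d ∧ Nontrivial (extQuotient I M d)

lemma DepthGE.right {d : ℕ} (hf : Function.Injective f) (hfg : Function.Exact f g)
    (hg : Function.Surjective g) (hA : DepthGE I A (d + 1)) (hB : DepthGE I B d) :
    DepthGE I C d := fun i hi =>
  extQuotient_subsingleton_right hf hfg hg (hB i hi) (hA (i + 1) (by lia))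

/-- If the submodule has depth `d` and the quotient has depth at least `d`, then the middle term
has depth `d`. -/
lemma HasDepth.middle {d : ℕ} (hf : Function.Injective f) (hfg : Function.Exact f g)
    (hg : Function.Surjective g) (hA : HasDepth I A d) (hC : DepthGE I C d) :
    HasDepth I B d := by
  refine ⟨fun i hi => extQuotient_subsingleton_middle hf hfg hg (hA.1 i hi) (hC i hi), ?_⟩
  by_contra h
  rw [not_nontrivial_iff_subsingleton] at h
  refine not_subsingleton_iff_nontrivial.2 hA.2 ?_
  rcases d with _ | d
  · exact extQuotient_zero_subsingleton_left hf h
  · exact extQuotient_succ_subsingleton_left hf hfg hg (hC d (by lia)) h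

/-- The depth drops by one on passing to the quotient by a regular element. -/
lemma HasDepth.of_regular {d : ℕ} {r : R} (hr : r ∈ I) {g : A →ₗ[R] C}
    (hf : Function.Injective (r • (LinearMap.id : A →ₗ[R] A)))
    (hfg : Function.Exact (r • (LinearMap.id : A →ₗ[R] A)) g) (hg : Function.Surjective g)
    (hC : HasDepth I C d) : HasDepth I A (d + 1) := by
  have hA : DepthGE I A (d + 1) := by
    rintro (_ | i) hi
    · exact extQuotient_zero_subsingleton_of_regular hr hf
    · exact extQuotient_succ_subsingleton_of_regular hr hf hfg hg (hC.1 i (by lia))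
  exact ⟨hA, extQuotient_nontrivial_left hf hfg hg (hA d (by lia)) hC.2⟩

lemma hasDepth_self (hI : I ≠ ⊤) : HasDepth I (R ⧸ I) 0 := by
  refine ⟨fun i hi => absurd hi (Nat.not_lt_zero i), ?_⟩
  refine nontrivial_of_ne (Abelian.Ext.mk₀ (𝟙 (ModuleCat.of R (R ⧸ I)))) 0 fun h => ?_
  rw [Abelian.Ext.mk₀_eq_zero_iff] at h
  have h1 := congrArg (fun φ => φ.hom (1 : R ⧸ I)) h
  have : Nontrivial (R ⧸ I) := Ideal.Quotient.nontrivial_iff.2 hI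
  exact one_ne_zero (α := R ⧸ I) h1

end ExtOfModules

lemma HasDepth.gradedDepth_eq {K : Type u} [Field K] {σ : Type} {M : Type u} [AddCommGroup M]
    [Module (MvPolynomial σ K) M] {d : ℕ} (h : HasDepth (idealOfVars σ K) M d) :
    gradedDepth K σ M = d := by
  refine le_antisymm (iInf₂_le d h.2) (le_iInf₂ fun i hi => ?_)
  by_contra hlt
  exact not_subsingleton_iff_nontrivial.2 hi (h.1 i (by simpa using hlt))

/-! ### Exact sequences from colon ideals -/

section Colon

variable {R : Type u} [CommRing R]

/-- If `A = (B : r)`, multiplication by `r` gives a short exact sequence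
`0 → R/A → R/B → R/(B + (r)) → 0`. The ideal `C = B + (r)` is a variable, so that it can be given
in another form. -/
lemma exists_exact_of_colon {A B C : Ideal R} {r : R} (hA : ∀ f, r * f ∈ B ↔ f ∈ A)
    (hC : C = B ⊔ Ideal.span {r}) :
    ∃ (φ : (R ⧸ A) →ₗ[R] R ⧸ B) (ψ : (R ⧸ B) →ₗ[R] R ⧸ C),
      (∀ f, φ (Ideal.Quotient.mk A f) = Ideal.Quotient.mk B (r * f)) ∧
      Function.Injective φ ∧ Function.Exact φ ψ ∧ Function.Surjective ψ := by
  refine ⟨Submodule.mapQ A B (r • LinearMap.id) (fun f hf => by simpa using (hA f).2 hf),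
    Submodule.factor (hC ▸ le_sup_left), fun f => rfl, ?_, ?_, Submodule.factor_surjective _⟩
  · rw [injective_iff_map_eq_zero]
    intro x hx
    obtain ⟨f, rfl⟩ := Ideal.Quotient.mk_surjective x
    rw [Ideal.Quotient.eq_zero_iff_mem, ← hA, ← Ideal.Quotient.eq_zero_iff_mem]
    exact hx
  · intro x
    obtain ⟨f, rfl⟩ := Ideal.Quotient.mk_surjective x
    have h1 : (Submodule.factor (hC ▸ le_sup_left : B ≤ C)) (Ideal.Quotient.mk B f)
      = Ideal.Quotient.mk C f := rfl
    rw [h1, Ideal.Quotient.eq_zero_iff_mem, hC]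
    constructor
    · intro hf
      obtain ⟨b, hb, c, hc, rfl⟩ := Submodule.mem_sup.1 hf
      obtain ⟨d, rfl⟩ := Ideal.mem_span_singleton'.1 hc
      refine ⟨Ideal.Quotient.mk A d, ?_⟩
      change Ideal.Quotient.mk B (r * d) = _
      rw [Ideal.Quotient.eq]
      convert B.neg_mem hb using 1
      ring
    · rintro ⟨y, hy⟩
      obtain ⟨d, rfl⟩ := Ideal.Quotient.mk_surjective y
      have h2 : Ideal.Quotient.mk B (r * d) = Ideal.Quotient.mk B f := hy
      rw [Ideal.Quotient.eq] at h2
      have : f = -(r * d - f) + d * r := by ring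
      rw [this]
      exact Submodule.add_mem_sup (B.neg_mem h2) (Ideal.mem_span_singleton'.2 ⟨d, rfl⟩)

/-- If `r` is regular modulo `A`, the maps of `exists_exact_of_colon` can be written with
multiplication by `r` on `R/A`. -/
lemma exists_exact_of_regular {A C : Ideal R} {r : R} (hA : ∀ f, r * f ∈ A ↔ f ∈ A)
    (hC : C = A ⊔ Ideal.span {r}) :
    ∃ ψ : (R ⧸ A) →ₗ[R] R ⧸ C,
      Function.Injective (r • (LinearMap.id : (R ⧸ A) →ₗ[R] R ⧸ A)) ∧
      Function.Exact (r • (LinearMap.id : (R ⧸ A) →ₗ[R] R ⧸ A)) ψ ∧ Function.Surjective ψ := by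
  obtain ⟨φ, ψ, h, h1, h2, h3⟩ := exists_exact_of_colon hA hC
  have : φ = r • LinearMap.id := by
    ext
    simpa [Algebra.smul_def] using h 1
  subst this
  exact ⟨ψ, h1, h2, h3⟩

end Colon

/-! ### Depth of quotients by variables and by products of all but one variable -/

section MonomialIdeals

variable {K : Type u} [Field K] {σ : Type}

lemma X_mem_idealOfVars (a : σ) : (X a : MvPolynomial σ K) ∈ idealOfVars σ K :=
  Ideal.subset_span ⟨a, rfl⟩

lemma X_mul_mem_span_X_image {T : Set σ} {a : σ} (ha : a ∉ T) (f : MvPolynomial σ K) :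
    X a * f ∈ Ideal.span (X '' T) ↔ f ∈ Ideal.span (X '' T : Set (MvPolynomial σ K)) := by
  classical
  refine ⟨fun h => ?_, fun h => Ideal.mul_mem_left _ _ h⟩
  rw [mem_ideal_span_X_image] at h ⊢
  intro m hm
  obtain ⟨i, hi, hmi⟩ := h (Finsupp.single a 1 + m) (by
    rwa [mem_support_iff, coeff_X_mul, ← mem_support_iff])
  refine ⟨i, hi, ?_⟩
  have : a ≠ i := fun h => ha (h ▸ hi)
  simpa [Finsupp.single_apply, this] using hmi

lemma span_X_image_insert [DecidableEq σ] (a : σ) (T : Finset σ) :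
    Ideal.span (X '' (insert a T : Finset σ) : Set (MvPolynomial σ K)) =
      Ideal.span (X '' (T : Set σ)) ⊔ Ideal.span {X a} := by
  rw [Finset.coe_insert, Set.image_insert_eq, ← Set.union_singleton, Ideal.span_union]

lemma idealOfVars_ne_top : idealOfVars σ K ≠ ⊤ := by
  rw [Ne, Ideal.eq_top_iff_one]
  intro h
  have := (C_mem_pow_idealOfVars_iff (σ := σ) 1 (1 : K)).1 (by simpa using h)
  simp at this

/-- `S/(x_t : t ∈ T)` has depth `|σ| - |T|`. -/
lemma hasDepth_span_X_image [Fintype σ] (d : ℕ) (T : Finset σ)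
    (hT : T.card + d = Fintype.card σ) :
    HasDepth (idealOfVars σ K)
      (MvPolynomial σ K ⧸ Ideal.span (X '' (T : Set σ) : Set (MvPolynomial σ K))) d := by
  classical
  induction d generalizing T with
  | zero =>
    obtain rfl : T = Finset.univ := (Finset.card_eq_iff_eq_univ T).1 hT
    rw [Finset.coe_univ, Set.image_univ]
    exact hasDepth_self idealOfVars_ne_top
  | succ d ih =>
    obtain ⟨a, ha⟩ : ∃ a, a ∉ T := by
      by_contra! h
      rw [Finset.eq_univ_iff_forall.2 h, Finset.card_univ] at hT
      lia
    obtain ⟨ψ, h1, h2, h3⟩ := exists_exact_of_regular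
      (fun f => X_mul_mem_span_X_image (K := K) (T := (T : Set σ)) (a := a) (by simpa using ha) f)
      (span_X_image_insert a T)
    exact HasDepth.of_regular (X_mem_idealOfVars a) h1 h2 h3
      (ih _ (by rw [Finset.card_insert_of_notMem ha]; lia))

/-- The ideal generated by the products of all but one of the variables in `s`; for nonempty `s`
this is the squarefree Veronese ideal of degree `|s| - 1` in these variables. -/
noncomputable def omitOneIdeal (K : Type u) [Field K] {σ : Type} [DecidableEq σ] (s : Finset σ) :
    Ideal (MvPolynomial σ K) :=
  Ideal.span ((fun k => ∏ l ∈ s.erase k, X l) '' (s : Set σ))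

lemma prod_X_eq_monomial (s : Finset σ) :
    ∏ l ∈ s, (X l : MvPolynomial σ K) = monomial (∑ l ∈ s, Finsupp.single l 1) 1 := by
  rw [monomial_sum_one]
  rfl

variable [DecidableEq σ]

open scoped Pointwise in
lemma omitOneIdeal_insert {a : σ} {s : Finset σ} (ha : a ∉ s) :
    omitOneIdeal K (insert a s) =
      Ideal.span {X a} * omitOneIdeal K s ⊔ Ideal.span {∏ l ∈ s, X l} := by
  have h : (fun k => ∏ l ∈ (insert a s).erase k, (X l : MvPolynomial σ K)) '' (s : Set σ) =
      ({X a} : Set (MvPolynomial σ K)) * (fun k => ∏ l ∈ s.erase k, (X l : MvPolynomial σ K)) '' (s : Set σ) := by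
    rw [Set.singleton_mul, Set.image_image]
    refine Set.image_congr fun k hk => ?_
    have hk' : a ≠ k := fun h => ha (h ▸ hk)
    rw [Finset.erase_insert_of_ne hk', Finset.prod_insert (by simp [ha])]
  rw [omitOneIdeal, Finset.coe_insert, Set.image_insert_eq, ← Set.union_singleton,
    Ideal.span_union, h, Finset.erase_insert ha, omitOneIdeal, Ideal.span_mul_span']

lemma prod_X_mem_omitOneIdeal {s : Finset σ} (hs : s.Nonempty) :
    ∏ l ∈ s, (X l : MvPolynomial σ K) ∈ omitOneIdeal K s := by
  obtain ⟨k, hk⟩ := hs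
  rw [← Finset.mul_prod_erase s _ hk]
  exact Ideal.mul_mem_left _ _ (Ideal.subset_span ⟨k, hk, rfl⟩)

lemma X_dvd_prod_X_mul {a : σ} {s : Finset σ} (ha : a ∉ s) {f : MvPolynomial σ K}
    (h : X a ∣ (∏ l ∈ s, X l) * f) : X a ∣ f := by
  refine (X_dvd_mul_iff.1 h).resolve_left fun h => ?_
  rw [prod_X_eq_monomial, X_dvd_monomial, Finsupp.finsetSum_apply] at h
  simp [Finsupp.single_apply, ha] at h

lemma X_mul_mem_omitOneIdeal_insert {a : σ} {s : Finset σ} (ha : a ∉ s) (hs : s.Nonempty)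
    (f : MvPolynomial σ K) : X a * f ∈ omitOneIdeal K (insert a s) ↔ f ∈ omitOneIdeal K s := by
  rw [omitOneIdeal_insert ha]
  refine ⟨fun h => ?_, fun h => Submodule.mem_sup_left
    (Ideal.mul_mem_mul (Ideal.mem_span_singleton_self _) h)⟩
  obtain ⟨b, hb, c, hc, hbc⟩ := Submodule.mem_sup.1 h
  obtain ⟨b, hb', rfl⟩ := Ideal.mem_span_singleton_mul.1 hb
  obtain ⟨c, rfl⟩ := Ideal.mem_span_singleton.1 hc
  obtain ⟨c, rfl⟩ := X_dvd_prod_X_mul ha (f := c)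
    ((dvd_add_right (dvd_mul_right _ b)).1 (hbc ▸ dvd_mul_right _ f))
  have : f = b + (∏ l ∈ s, X l) * c :=
    mul_left_cancel₀ (X_ne_zero (R := K) a) (by rw [← hbc]; ring)
  rw [this]
  exact add_mem hb' (Ideal.mul_mem_right _ _ (prod_X_mem_omitOneIdeal hs))

lemma omitOneIdeal_insert_sup (a : σ) {s : Finset σ} (ha : a ∉ s) :
    Ideal.span {X a} ⊔ Ideal.span {∏ l ∈ s, (X l : MvPolynomial σ K)} =
      omitOneIdeal K (insert a s) ⊔ Ideal.span {X a} := by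
  rw [omitOneIdeal_insert ha]
  rw [sup_right_comm, sup_eq_right.2 (Ideal.mul_le_left (I := Ideal.span {X a}))]

/-- `x_a` and `∏_{l ∈ s} x_l` form a regular sequence for `a ∉ s`, so that the quotient by them has
depth at least `|σ| - 2`. -/
lemma depthGE_span_X_sup_span_prod [Fintype σ] {a : σ} {s : Finset σ} (ha : a ∉ s)
    {d : ℕ} (hd : d + 2 = Fintype.card σ) :
    DepthGE (idealOfVars σ K) (MvPolynomial σ K ⧸
      (Ideal.span {X a} ⊔ Ideal.span {∏ l ∈ s, (X l : MvPolynomial σ K)})) d := by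
  have h0 := hasDepth_span_X_image (K := K) (d + 1) {a} (by simp; lia)
  rw [Finset.coe_singleton, Set.image_singleton] at h0
  have hc (f : MvPolynomial σ K) :
      (∏ l ∈ s, X l) * f ∈ Ideal.span {X a} ↔ f ∈ Ideal.span {X a} := by
    rw [Ideal.mem_span_singleton, Ideal.mem_span_singleton]
    exact ⟨X_dvd_prod_X_mul ha, fun h => h.mul_left _⟩
  obtain ⟨ψ, h1, h2, h3⟩ := exists_exact_of_regular hc rfl
  exact DepthGE.right h1 h2 h3 h0.1 fun i hi => h0.1 i (by lia)

lemma omitOneIdeal_pair {a b : σ} (hab : a ≠ b) :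
    omitOneIdeal K {a, b} = Ideal.span (X '' (({a, b} : Finset σ) : Set σ)) := by
  have h1 : ({a, b} : Finset σ).erase a = {b} := by ext; simp; grind
  have h2 : ({a, b} : Finset σ).erase b = {a} := by ext; simp; grind
  simp [omitOneIdeal, Set.image_insert_eq, h1, h2, Set.pair_comm]

/-- The induction over `s` uses the exact sequences
`0 → S/J_s → S/J_{s ∪ {a}} → S/(x_a, ∏_{l ∈ s} x_l) → 0`, where the first map is multiplication
by `x_a`. -/
theorem hasDepth_omitOneIdeal [Fintype σ] {d : ℕ} (hd : d + 2 = Fintype.card σ) (s : Finset σ)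
    (hs : 2 ≤ s.card) :
    HasDepth (idealOfVars σ K) (MvPolynomial σ K ⧸ omitOneIdeal K s) d := by
  induction s using Finset.induction_on with
  | empty => simp at hs
  | insert a s ha ih =>
    rw [Finset.card_insert_of_notMem ha] at hs
    obtain hs1 | hs2 : s.card = 1 ∨ 2 ≤ s.card := by lia
    · obtain ⟨b, rfl⟩ := Finset.card_eq_one.1 hs1
      have hab : a ≠ b := by simpa using ha
      rw [omitOneIdeal_pair hab]
      exact hasDepth_span_X_image d _ (by rw [Finset.card_pair hab]; lia)
    · have hne : s.Nonempty := Finset.card_pos.1 (by lia)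
      obtain ⟨φ, ψ, -, h1, h2, h3⟩ := exists_exact_of_colon
        (X_mul_mem_omitOneIdeal_insert (K := K) ha hne) (omitOneIdeal_insert_sup a ha)
      exact HasDepth.middle h1 h2 h3 (ih hs2) (depthGE_span_X_sup_span_prod ha hd)

lemma sum_single_apply (s : Finset σ) (k : σ) :
    (∑ l ∈ s, Finsupp.single l 1 : σ →₀ ℕ) k = if k ∈ s then 1 else 0 := by
  simp [Finsupp.finsetSum_apply, Finsupp.single_apply]

lemma sum_single_le_iff (s : Finset σ) (m : σ →₀ ℕ) :
    ∑ l ∈ s, Finsupp.single l 1 ≤ m ↔ ∀ l ∈ s, m l ≠ 0 := by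
  rw [Finsupp.le_def]
  simp only [sum_single_apply]
  refine forall_congr' fun l => ?_
  split_ifs with h <;> simp [h, Nat.one_le_iff_ne_zero]

lemma mem_omitOneIdeal_iff {s : Finset σ} {f : MvPolynomial σ K} :
    f ∈ omitOneIdeal K s ↔ ∀ m ∈ f.support, ∃ k ∈ s, ∀ l ∈ s.erase k, m l ≠ 0 := by
  have : omitOneIdeal K s = Ideal.span ((fun m => monomial m (1 : K)) ''
      ((fun k => ∑ l ∈ s.erase k, Finsupp.single l 1) '' (s : Set σ))) := by
    rw [Set.image_image, omitOneIdeal]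
    simp only [prod_X_eq_monomial]
  rw [this, mem_ideal_span_monomial_image]
  simp only [Set.exists_mem_image, sum_single_le_iff, Finset.mem_coe]

end MonomialIdeals

/-! ### Paths with `n - 1` vertices in the `n`-cycle -/

section Cycle

variable {K : Type u} [Field K]

/-- The vertices `k+1, k+2, …, k+n-1` form a path of the `n`-cycle that misses only `k`. -/
lemma exists_isPath_cycleGraph {n : ℕ} (k : Fin (n + 2)) :
    ∃ (v w : Fin (n + 2)) (p : (SimpleGraph.cycleGraph (n + 2)).Walk v w), p.IsPath ∧
      p.support.length = n + 1 ∧ k ∉ p.support := by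
  set l := List.ofFn (fun i : Fin (n + 1) => k + i.succ) with hl
  have hc : l.IsChain (SimpleGraph.cycleGraph (n + 2)).Adj := by
    rw [List.isChain_iff_getElem]
    intro i hi
    rw [SimpleGraph.cycleGraph_adj]
    right
    simp only [hl, List.getElem_ofFn]
    rw [add_sub_add_left_eq_sub, sub_eq_iff_eq_add, Fin.ext_iff]
    have hi' : i < n := by simpa [hl] using hi
    simp only [Fin.val_succ, Fin.val_add, Fin.val_one]
    rw [Nat.mod_eq_of_lt (by lia), add_comm]
  refine ⟨_, _, SimpleGraph.Walk.ofSupport l (by simp [hl]) hc, ?_, ?_, ?_⟩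
  · rw [SimpleGraph.Walk.isPath_def, SimpleGraph.Walk.support_ofSupport, hl, List.nodup_ofFn]
    intro i j hij
    simpa using hij
  · simp [hl]
  · simp [hl, List.mem_ofFn]

lemma cyclePathIdeal_eq_omitOneIdeal (n : ℕ) :
    cyclePathIdeal K (n + 2) (n + 1) = omitOneIdeal K Finset.univ := by
  have key : ∀ (k : Fin (n + 2)) (l : List (Fin (n + 2))), l.Nodup → l.length = n + 1 → k ∉ l →
      (l.map (fun i => (X i : MvPolynomial _ K))).prod = ∏ i ∈ Finset.univ.erase k, X i := by
    intro k l hl hlen hk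
    rw [← List.prod_toFinset _ hl]
    congr 1
    apply Finset.eq_of_subset_of_card_le
    · intro i hi
      simp only [List.mem_toFinset] at hi
      simp only [Finset.mem_erase, Finset.mem_univ, and_true]
      rintro rfl
      exact hk hi
    · rw [List.toFinset_card_of_nodup hl, hlen]
      simp
  apply le_antisymm
  · refine Ideal.span_le.2 ?_
    rintro _ ⟨v, w, p, hp, hlen, rfl⟩
    have hnd : p.support.Nodup := (SimpleGraph.Walk.isPath_def p).1 hp
    obtain ⟨k, hk⟩ : ∃ k, k ∉ p.support := by
      by_contra! h
      have := List.toFinset_card_of_nodup hnd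
      rw [Finset.eq_univ_iff_forall.2 (fun i => List.mem_toFinset.2 (h i))] at this
      simp [hlen] at this
    exact Ideal.subset_span ⟨k, by simp, (key k _ hnd hlen hk).symm⟩
  · refine Ideal.span_le.2 ?_
    rintro _ ⟨k, -, rfl⟩
    obtain ⟨v, w, p, hp, hlen, hk⟩ := exists_isPath_cycleGraph k
    exact Ideal.subset_span ⟨v, w, p, hp, hlen,
      (key k _ ((SimpleGraph.Walk.isPath_def p).1 hp) hlen hk).symm⟩

end Cycle

/-! ### Stanley decompositions from partitions of monomials -/

section StanleyOfPartition

variable {K : Type u} [Field K] {σ : Type} {I : Ideal (MvPolynomial σ K)} {E : Set (σ →₀ ℕ)}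

/-- The exponents of the monomials in `x^u K[Z]`. -/
def stanleyExponents (u : σ →₀ ℕ) (Z : Finset σ) : Set (σ →₀ ℕ) :=
  {b | u ≤ b ∧ ∀ k ∉ Z, b k = u k}

lemma support_mul_monomial_subset {u : σ →₀ ℕ} {Z : Finset σ} {f : MvPolynomial σ K}
    (hf : f ∈ supported K (Z : Set σ)) :
    ∀ b ∈ (f * monomial u 1).support, b ∈ stanleyExponents u Z := by
  classical
  intro b hb
  rw [mem_support_iff, coeff_mul_monomial'] at hb
  split_ifs at hb with hub
  · refine ⟨hub, fun k hk => ?_⟩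
    by_contra hne
    refine hk (mem_supported.1 hf ((mem_vars_iff_mem_support k).2 ⟨b - u, ?_, ?_⟩))
    · simpa [mem_support_iff] using hb
    · have := hub k
      simp only [Finsupp.mem_support_iff, Finsupp.tsub_apply]
      lia
  · exact absurd rfl hb

lemma mk_monomial_mem_stanleySubspace {u b : σ →₀ ℕ} {Z : Finset σ}
    (hb : b ∈ stanleyExponents u Z) :
    Ideal.Quotient.mk I (monomial b 1) ∈
      stanleySubspace (K := K) (Ideal.Quotient.mk I (monomial u 1)) Z := by
  refine ⟨monomial (b - u) 1, ?_, ?_⟩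
  · change monomial (b - u) (1 : K) ∈ supported K (Z : Set σ)
    rw [mem_supported, vars_monomial one_ne_zero]
    intro k hk
    by_contra hkZ
    simp [hb.2 k hkZ] at hk
  · change Ideal.Quotient.mk I (monomial (b - u) 1 * monomial u 1) = _
    rw [monomial_mul, tsub_add_cancel_of_le hb.1, one_mul]

lemma exists_of_mem_stanleySubspace {u : σ →₀ ℕ} {Z : Finset σ} {v : MvPolynomial σ K ⧸ I}
    (hv : v ∈ stanleySubspace (K := K) (Ideal.Quotient.mk I (monomial u 1)) Z) :
    ∃ F : MvPolynomial σ K, Ideal.Quotient.mk I F = v ∧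
      ∀ b ∈ F.support, b ∈ stanleyExponents u Z := by
  obtain ⟨f, hf, rfl⟩ := hv
  exact ⟨f * monomial u 1, rfl, support_mul_monomial_subset hf⟩

/-- The class of a monomial `x^u` generates a Stanley space `x^u K[Z]` of `S/I` if no monomial of
`x^u K[Z]` lies in the monomial ideal `I`, whose set of exponents is `E`. -/
lemma isStanleySpace_mk_monomial (hI : ∀ f, f ∈ I ↔ ∀ b ∈ f.support, b ∈ E) {u : σ →₀ ℕ}
    {Z : Finset σ} (hE : ∀ b ∈ stanleyExponents u Z, b ∉ E) :
    IsStanleySpace (quotientGrading I) (Ideal.Quotient.mk I (monomial u 1)) Z := by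
  refine ⟨⟨fun i => u i, Submodule.subset_span ⟨u, fun _ => rfl, rfl⟩⟩, fun f hf h => ?_⟩
  have h0 : f * monomial u 1 ∈ I := Ideal.Quotient.eq_zero_iff_mem.1 h
  have h1 : f * monomial u 1 = 0 := by
    rw [← support_eq_empty, Finset.eq_empty_iff_forall_notMem]
    exact fun b hb => hE b (support_mul_monomial_subset hf b hb) ((hI _).1 h0 b hb)
  exact (mul_eq_zero.1 h1).resolve_right (by simp)

/-- A partition of the monomials outside the monomial ideal `I` into sets of the form
`x^u · {monomials in Z}` gives a direct sum decomposition of `S/I`. -/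
lemma isInternal_stanleySubspace_of_partition {r : ℕ}
    (hI : ∀ f, f ∈ I ↔ ∀ b ∈ f.support, b ∈ E) (u : Fin r → σ →₀ ℕ) (Z : Fin r → Finset σ)
    (hE : ∀ t, ∀ b ∈ stanleyExponents (u t) (Z t), b ∉ E)
    (hcover : ∀ b ∉ E, ∃ t, b ∈ stanleyExponents (u t) (Z t))
    (hdisj : ∀ b s t, b ∈ stanleyExponents (u s) (Z s) → b ∈ stanleyExponents (u t) (Z t) →
      s = t) :
    DirectSum.IsInternal fun t =>
      stanleySubspace (K := K) (Ideal.Quotient.mk I (monomial (u t) 1)) (Z t) := by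
  apply DirectSum.isInternal_submodule_of_iSupIndep_of_iSup_eq_top
  · rw [iSupIndep_iff_finsetSum_eq_zero_imp_eq_zero]
    intro s v hv hsum t ht
    choose! F hF hsupp using fun i hi => exists_of_mem_stanleySubspace (hv i hi)
    have hmem : ∑ i ∈ s, F i ∈ I := by
      rw [← Ideal.Quotient.eq_zero_iff_mem, map_sum, ← hsum]
      exact Finset.sum_congr rfl hF
    suffices h : F t = 0 by rw [← hF t ht, h, map_zero]
    rw [← support_eq_empty, Finset.eq_empty_iff_forall_notMem]
    intro b hb
    refine hE t b (hsupp t ht b hb) ((hI _).1 hmem b ?_)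
    -- By disjointness, the coefficient of `x^b` in the sum is its coefficient in `F t`.
    rw [mem_support_iff, coeff_sum, Finset.sum_eq_single_of_mem t ht]
    · exact mem_support_iff.1 hb
    · intro i hi hit
      by_contra hne
      exact hit (hdisj b i t (hsupp i hi b (mem_support_iff.2 hne)) (hsupp t ht b hb))
  · rw [eq_top_iff]
    rintro x -
    obtain ⟨f, rfl⟩ := Ideal.Quotient.mk_surjective x
    rw [f.as_sum, map_sum]
    refine Submodule.sum_mem _ fun b _ => ?_
    have hb : Ideal.Quotient.mk I (monomial b (coeff b f)) =
        coeff b f • Ideal.Quotient.mk I (monomial b 1) := by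
      rw [← mul_one (coeff b f), ← smul_eq_mul, ← smul_monomial, smul_eq_mul, mul_one]
      rfl
    rw [hb]
    refine Submodule.smul_mem _ _ ?_
    by_cases hbE : b ∈ E
    · have : Ideal.Quotient.mk I (monomial b (1 : K)) = 0 := by
        rw [Ideal.Quotient.eq_zero_iff_mem, hI]
        intro m hm
        rwa [Finset.mem_singleton.1 (support_monomial_subset hm)]
      rw [this]
      exact zero_mem _
    · obtain ⟨t, ht⟩ := hcover b hbE
      exact Submodule.mem_iSup_of_mem t (mk_monomial_mem_stanleySubspace ht)

end StanleyOfPartition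

/-! ### The Stanley depth -/

section StanleyDepth

variable {K : Type u} [Field K] {n : ℕ}

/-- Every Stanley space `u K[Z]` of `S/J` satisfies `|Z| ≤ n - 2`, because a product of at least
`n - 1` variables lies in `J` and so kills `u`. -/
lemma IsStanleySpace.card_add_two_le {σ : Type} [Fintype σ] [DecidableEq σ]
    {𝓜 : (σ → ℤ) → Submodule K (MvPolynomial σ K ⧸ omitOneIdeal K (Finset.univ : Finset σ))}
    {u : MvPolynomial σ K ⧸ omitOneIdeal K (Finset.univ : Finset σ)} {Z : Finset σ}
    (h : IsStanleySpace 𝓜 u Z) (hσ : 2 ≤ Fintype.card σ) : Z.card + 2 ≤ Fintype.card σ := by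
  by_contra hlt
  have hcompl : Zᶜ.card ≤ 1 := by
    rw [Finset.card_compl]
    lia
  have : Nonempty σ := Fintype.card_pos_iff.1 (by lia)
  obtain ⟨k, hk⟩ : ∃ k, ∀ l ∈ Finset.univ.erase k, l ∈ Z := by
    obtain ⟨k, hk⟩ := Finset.card_le_one_iff_subset_singleton.1 hcompl
    refine ⟨k, fun l hl => ?_⟩
    by_contra hlZ
    have := hk (Finset.mem_compl.2 hlZ)
    simp_all
  have hmem : (∏ l ∈ Finset.univ.erase k, X l : MvPolynomial σ K) ∈
      omitOneIdeal K (Finset.univ : Finset σ) := Ideal.subset_span ⟨k, by simp, rfl⟩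
  have h0 := h.2 (∏ l ∈ Finset.univ.erase k, X l)
    (Subalgebra.prod_mem _ fun l hl => X_mem_supported.2 (hk l hl)) (by
      obtain ⟨f, rfl⟩ := Ideal.Quotient.mk_surjective u
      exact Ideal.Quotient.eq_zero_iff_mem.2 (Ideal.mul_mem_right f _ hmem))
  rw [Finset.prod_eq_zero_iff] at h0
  obtain ⟨l, -, hl⟩ := h0
  exact X_ne_zero l hl

/-- The pairs `i < j` that index the summands of the Stanley decomposition of `S/J`. -/
abbrev OrderedPair (n : ℕ) : Type := {p : Fin n × Fin n // p.1 < p.2}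

namespace OrderedPair

/-- The exponent of `∏_{k < j, k ≠ i} x_k`. -/
noncomputable def exponent (p : OrderedPair n) : Fin n →₀ ℕ :=
  ∑ k ∈ (Finset.Iio p.1.2).erase p.1.1, Finsupp.single k 1

/-- The variables other than `x_i` and `x_j`. -/
def freeVars (p : OrderedPair n) : Finset (Fin n) := {p.1.1, p.1.2}ᶜ

/-- The summand of the pair `i < j` consists of the monomials for which `x_i` and `x_j` are the
first two variables that do not occur. -/
lemma mem_stanleyExponents_iff (p : OrderedPair n) (b : Fin n →₀ ℕ) :
    b ∈ stanleyExponents p.exponent p.freeVars ↔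
      b p.1.1 = 0 ∧ b p.1.2 = 0 ∧ ∀ k < p.1.2, k ≠ p.1.1 → b k ≠ 0 := by
  obtain ⟨⟨i, j⟩, hij⟩ := p
  simp only [stanleyExponents, exponent, freeVars, Set.mem_ofPred_eq, sum_single_le_iff,
    sum_single_apply, Finset.mem_erase, Finset.mem_Iio, Finset.mem_compl, Finset.mem_insert,
    Finset.mem_singleton, not_not]
  constructor
  · rintro ⟨h1, h2⟩
    refine ⟨by simpa using h2 i (.inl rfl), by simpa using h2 j (.inr rfl), fun k hk hki =>
      h1 k ⟨hki, hk⟩⟩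
  · rintro ⟨h1, h2, h3⟩
    refine ⟨fun k hk => h3 k hk.2 hk.1, ?_⟩
    rintro k (rfl | rfl) <;> simp [h1, h2]

lemma eq_of_mem_stanleyExponents {p q : OrderedPair n} {b : Fin n →₀ ℕ}
    (hp : b ∈ stanleyExponents p.exponent p.freeVars)
    (hq : b ∈ stanleyExponents q.exponent q.freeVars) : p = q := by
  rw [mem_stanleyExponents_iff] at hp hq
  obtain ⟨⟨i, j⟩, hij⟩ := p
  obtain ⟨⟨i', j'⟩, hij'⟩ := q
  simp only at hp hq hij hij'
  have key : i = i' ∧ j = j' := by grind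
  simp [key]

lemma exists_mem_stanleyExponents {b : Fin n →₀ ℕ} (hn : 0 < n)
    (hb : ¬∃ k, ∀ l, l ≠ k → b l ≠ 0) :
    ∃ p : OrderedPair n, b ∈ stanleyExponents p.exponent p.freeVars := by
  push Not at hb
  obtain ⟨i, hi, hmin⟩ := WellFounded.has_min wellFounded_lt {i | b i = 0}
    (let ⟨l, _, hl⟩ := hb ⟨0, hn⟩; ⟨l, hl⟩)
  obtain ⟨j, ⟨hji, hj⟩, hjmin⟩ := WellFounded.has_min wellFounded_lt {j | j ≠ i ∧ b j = 0} (hb i)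
  refine ⟨⟨(i, j), lt_of_le_of_ne (not_lt.1 (hmin j hj)) hji.symm⟩, ?_⟩
  rw [mem_stanleyExponents_iff]
  exact ⟨hi, hj, fun k hk hki hbk => hjmin k ⟨hki, hbk⟩ hk⟩

lemma card_freeVars (p : OrderedPair n) : p.freeVars.card = n - 2 := by
  rw [freeVars, Finset.card_compl, Finset.card_pair p.2.ne, Fintype.card_fin]

end OrderedPair

lemma mem_omitOneIdeal_univ_iff (f : MvPolynomial (Fin n) K) :
    f ∈ omitOneIdeal K (Finset.univ : Finset (Fin n)) ↔
      ∀ b ∈ f.support, b ∈ {b : Fin n →₀ ℕ | ∃ k, ∀ l, l ≠ k → b l ≠ 0} := by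
  simp [mem_omitOneIdeal_iff]

lemma OrderedPair.notMem_of_mem_stanleyExponents (p : OrderedPair n) :
    ∀ b ∈ stanleyExponents p.exponent p.freeVars,
      b ∉ {b : Fin n →₀ ℕ | ∃ k, ∀ l, l ≠ k → b l ≠ 0} := by
  rintro b hb ⟨k, hk⟩
  obtain ⟨hi, hj, -⟩ := (p.mem_stanleyExponents_iff b).1 hb
  have h1 : p.1.1 = k := not_not.1 fun h => hk _ h hi
  have h2 : p.1.2 = k := not_not.1 fun h => hk _ h hj
  exact p.2.ne (h1.trans h2.symm)

/-- The Stanley decomposition of `S/J` into the spaces `(∏_{k < j, k ≠ i} x_k) K[x_l : l ≠ i, j]`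
for `i < j`. -/
noncomputable def omitOneStanleyDecomposition (K : Type u) [Field K] {n : ℕ} (hn : 0 < n) :
    StanleyDecomposition (quotientGrading (omitOneIdeal K (Finset.univ : Finset (Fin n)))) where
  r := Fintype.card (OrderedPair n)
  u t := Ideal.Quotient.mk _ (monomial ((Fintype.equivFin (OrderedPair n)).symm t).exponent 1)
  Z t := ((Fintype.equivFin (OrderedPair n)).symm t).freeVars
  isStanleySpace t := isStanleySpace_mk_monomial mem_omitOneIdeal_univ_iff
    (OrderedPair.notMem_of_mem_stanleyExponents _)
  isInternal := isInternal_stanleySubspace_of_partition mem_omitOneIdeal_univ_iff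
    (fun t => ((Fintype.equivFin (OrderedPair n)).symm t).exponent)
    (fun t => ((Fintype.equivFin (OrderedPair n)).symm t).freeVars)
    (fun _ => OrderedPair.notMem_of_mem_stanleyExponents _)
    (fun b hb => by
      obtain ⟨p, hp⟩ := OrderedPair.exists_mem_stanleyExponents hn hb
      exact ⟨Fintype.equivFin _ p, by simpa using hp⟩)
    (fun b s t hs ht => (Fintype.equivFin (OrderedPair n)).symm.injective
      (OrderedPair.eq_of_mem_stanleyExponents hs ht))

theorem stanleyDepth_omitOneIdeal (K : Type u) [Field K] {n : ℕ} (hn : 2 ≤ n) :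
    stanleyDepth (quotientGrading (omitOneIdeal K (Finset.univ : Finset (Fin n))))
      = ((n - 2 : ℕ) : ℕ∞) := by
  apply le_antisymm
  · refine iSup_le fun D => ?_
    -- There is at least one summand, since `S/J` is not zero.
    obtain ⟨t⟩ : Nonempty (Fin D.r) := by
      by_contra hempty
      rw [not_nonempty_iff] at hempty
      have htop := D.isInternal.submodule_iSup_eq_top
      rw [iSup_of_empty] at htop
      have h1 : Ideal.Quotient.mk (omitOneIdeal K (Finset.univ : Finset (Fin n))) 1 ∈
          (⊥ : Submodule K _) := htop ▸ Submodule.mem_top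
      rw [Submodule.mem_bot, Ideal.Quotient.eq_zero_iff_mem, mem_omitOneIdeal_univ_iff] at h1
      obtain ⟨k, hk⟩ := h1 0 (by simp)
      have : Nontrivial (Fin n) := Fin.nontrivial_iff_two_le.2 hn
      obtain ⟨l, hl⟩ := exists_ne k
      exact hk l hl rfl
    refine (iInf_le _ t).trans ?_
    have := (D.isStanleySpace t).card_add_two_le (by simpa using hn)
    rw [Fintype.card_fin] at this
    exact_mod_cast (by lia : (D.Z t).card ≤ n - 2)
  · refine le_iSup_of_le (omitOneStanleyDecomposition K (by lia)) (le_iInf fun t => ?_)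
    exact_mod_cast (OrderedPair.card_freeVars _).ge

end StanleyDepth

theorem proposition3p1 {K : Type*} [Field K] (n : ℕ) (hn : 3 ≤ n) :
    stanleyDepth (quotientGrading (cyclePathIdeal K n (n - 1))) = ((n - 2 : ℕ) : ℕ∞) ∧
    gradedDepth K (Fin n) (MvPolynomial (Fin n) K ⧸ cyclePathIdeal K n (n - 1))
      = ((n - 2 : ℕ) : ℕ∞) := by
  obtain ⟨m, rfl⟩ : ∃ m, n = m + 2 := ⟨n - 2, by lia⟩
  rw [show m + 2 - 1 = m + 1 from rfl, cyclePathIdeal_eq_omitOneIdeal]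
  exact ⟨stanleyDepth_omitOneIdeal K (by lia),
    (hasDepth_omitOneIdeal (by simp) _ (by simp)).gradedDepth_eq⟩
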